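/- Let $\mathbb F_q$ be a finite field, let $\bar n,u,\bar k,v,\bar d$ be integers with $0\le v\le u-1$, $k=\bar ku+v\ge u$ and $\bar k\le\bar d\le\bar n-1$, and put $n=\bar nu$, $\bar s=\bar d-\bar k+1$. Let $p_1,\dots,p_{\bar n}$ be distinct primes with $p_i\equiv1\pmod{\bar s}$ and $p_i>u$. Let $\lambda_1,\dots,\lambda_{\bar n}$ be elements, of degrees $p_1,\dots,p_{\bar n}$ over $\mathbb F_q$, of an extension field $\mathbb K$ of $\mathbb F_q$ such that $[\mathbb K:\mathbb F]=\bar s$, where $\mathbb F=\mathbb F_q(\lambda_1,\dots,\lambda_{\bar n})$. Put $F_i=\mathbb F_q(\lambda_j: j\ne i)$ and $l=[\mathbb K:\mathbb F_q]$. Let $\lambda\in\mathbb F_q$ be an element of multiplicative order $u$ (so $u\mid q-1$), and let $\lambda_{ij}=\lambda_i\lambda^{j-1}$ for $1\le i\le\bar n$, $1\le j\le u$. Let $$\mathcal C=\{(f(\lambda_{ij}))_{1\le i\le\bar n,\,1\le j\le u}: f\in\mathbb K[x],\ \deg f<k\}$$ be the Reed–Solomon code of length $n$ over $\mathbb K$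 with evaluation points $\lambda_{ij}$. The node $(i,j)$ stores the symbol $c_{ij}\in\mathbb K\cong\mathbb F_q^l$, and the $u$ nodes $(i,1),\dots,(i,u)$ form rack $i$. For a failed node $(m,j^\ast)$, a linear repair scheme with $\bar d$ helper racks consists of integers $\beta_i\ge0$ and $\mathbb F_q$-linear maps $f_i:\mathbb K^u\to\mathbb F_q^{\beta_i}$ (depending on $i,m,j^\ast$ only) and, for every set $\mathcal R\subseteq\{1,\dots,\bar n\}\setminus\{m\}$ of $\bar d$ helper racks, of an $\mathbb F_q$-linear map $g_{\mathcal R}$ such that, for every $c\in\mathcal C$, $$g_{\mathcal R}\big((f_i(c_{i1},\dots,c_{iu}))_{i\in\mathcal R},\,(c_{mj})_{j\ne j^\ast}\big)=c_{mj^\ast}.$$ Its bandwidth for $\mathcal R$ is $\sum_{i\in\mathcal R}\beta_i$ (symbols of $\mathbb F_q$). Then: 1. For every $i$ there is an $F_i$-subspace $S_i$ of $\mathbb K$ with $\dim_{F_i}S_i=p_i$ and $S_i+S_i\lambda_i^u+\dots+S_i\lambda_i^{u(\bar s-1)}=\mathbb K$ (Minkowski sum, where $S_i\beta=\{\gamma\beta:\gamma\in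 S_i\}$). 2. $l=\bar s\prod_{i=1}^{\bar n}p_i$; the $n$ points $\lambda_{ij}$ are distinct; and $\mathcal C$ is an $(n,k,l)$ MDS array code over $\mathbb F_q$, that is, $\dim_{\mathbb F_q}\mathcal C=kl$ and any $k$ coordinates of a codeword determine it. 3. $\mathcal C$ supports optimal repair of a single failed node in any rack from any $\bar d$ helper racks: for every node $(m,j^\ast)$ there is a linear repair scheme whose bandwidth, for every set $\mathcal R\subseteq\{1,\dots,\bar n\}\setminus\{m\}$ of $\bar d$ helper racks, equals the rack-aware cut-set value $\dfrac{\bar d\,l}{\bar d-\bar k+1}=\dfrac{\bar d\,l}{\bar s}$. -/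

import Mathlib

open scoped Pointwise

noncomputable section

namespace RackRS

/-- The Reed-Solomon code over `K` of dimension parameter `k` with evaluation points `ω t`, `t ∈ ι`:
all vectors `(f (ω t))_t` with `f ∈ K[x]` of degree less than `k`. -/
def reedSolomon {ι : Type*} (K : Type*) [Field K] (k : ℕ) (ω : ι → K) : Submodule K (ι → K) :=
  (Polynomial.degreeLT K k).map (LinearMap.pi fun t => Polynomial.leval (ω t))

/-- An `F`-linear array code `C`, whose nodes (coordinates) store vectors of the `F`-space `V` of
dimension `l` (the node size), is an `(n, k, l)` MDS code: it has `|F| ^ (k * l)` codewords (it has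
dimension `k * l` over `F`), and every codeword is determined by any `k` of its nodes. -/
def IsMDS {F V ι : Type*} [Field F] [AddCommGroup V] [Module F V]
    (C : Submodule F (ι → V)) (k : ℕ) : Prop :=
  Module.finrank F C = k * Module.finrank F V ∧
    ∀ T : Finset ι, T.card = k → ∀ c ∈ C, ∀ c' ∈ C, (∀ t ∈ T, c t = c' t) → c = c'

/-- A linear repair scheme with repair degree `dbar` for the failed node `(m, j)` (the node with
index `j` in the host rack `m`) of an array code whose nodes are placed in `nbar` racks of size `u`.
The helper rack `i` computes `β i` symbols of `F` from the contents of all its nodes. From the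
symbols sent by the racks of a helper set `R` and the surviving nodes of the host rack, `g R`
recovers the failed node. The functions `f i` depend on `i`, `m`, `j`, but not on `R`. -/
structure LinearRepairScheme {F V : Type*} [Field F] [AddCommGroup V] [Module F V] {nbar u : ℕ}
    (C : Submodule F (Fin nbar × Fin u → V)) (dbar : ℕ) (m : Fin nbar) (j : Fin u) where
  β : Fin nbar → ℕ
  f : (i : Fin nbar) → (Fin u → V) →ₗ[F] (Fin (β i) → F)
  g : (R : Finset (Fin nbar)) →
    (((i : R) → Fin (β i) → F) × ({j' : Fin u // j' ≠ j} → V)) →ₗ[F] V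
  repairs : ∀ R : Finset (Fin nbar), R.card = dbar → m ∉ R → ∀ c ∈ C,
    g R (fun i => f i (fun j' => c (i, j')), fun j' => c (m, j')) = c (m, j)

/-- The (inter-rack) repair bandwidth from the helper racks in `R`: the number of symbols of `F`
sent to the host rack. -/
def LinearRepairScheme.bandwidth {F V : Type*} [Field F] [AddCommGroup V] [Module F V] {nbar u : ℕ}
    {C : Submodule F (Fin nbar × Fin u → V)} {dbar : ℕ} {m : Fin nbar} {j : Fin u}
    (S : LinearRepairScheme C dbar m j) (R : Finset (Fin nbar)) : ℕ :=
  ∑ i ∈ R, S.β i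

/-- The code supports optimal repair of any single failed node from any `dbar` helper racks: the
bandwidth always equals the rack-aware cut-set value `dbar * l / (dbar - kbar + 1)`, where `l` is
the node size over `F`. -/
def SupportsOptimalRepair {F V : Type*} [Field F] [AddCommGroup V] [Module F V] {nbar u : ℕ}
    (C : Submodule F (Fin nbar × Fin u → V)) (kbar dbar : ℕ) : Prop :=
  ∀ (m : Fin nbar) (j : Fin u), ∃ S : LinearRepairScheme C dbar m j,
    ∀ R : Finset (Fin nbar), R.card = dbar → m ∉ R →
      (S.bandwidth R : ℚ) =
        (dbar : ℚ) * (Module.finrank F V : ℚ) / ((dbar : ℚ) - (kbar : ℚ) + 1)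

/-- The evaluation points `lam i * lam0 ^ j`, with `j` counted from `0`. -/
def evalPoint {Fq K : Type*} [Field Fq] [Field K] [Algebra Fq K] {nbar u : ℕ}
    (lam : Fin nbar → K) (lam0 : Fq) (t : Fin nbar × Fin u) : K :=
  lam t.1 * algebraMap Fq K lam0 ^ (t.2 : ℕ)

/-- The field generated over `Fq` by all `lam j`. -/
abbrev fullField (Fq : Type*) {K : Type*} [Field Fq] [Field K] [Algebra Fq K] {nbar : ℕ}
    (lam : Fin nbar → K) : IntermediateField Fq K :=
  IntermediateField.adjoin Fq (Set.range lam)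

/-- The field generated over `Fq` by the `lam j` with `j ≠ i`. -/
abbrev omitField (Fq : Type*) {K : Type*} [Field Fq] [Field K] [Algebra Fq K] {nbar : ℕ}
    (lam : Fin nbar → K) (i : Fin nbar) : IntermediateField Fq K :=
  IntermediateField.adjoin Fq (lam '' {j | j ≠ i})

end RackRS

end

noncomputable section

namespace RackRS

open Polynomial IntermediateField

/-! All points of rack `i` have the same `u`-th power `λ_i^u`. Dual parity checks given by
polynomials in `X^u` therefore see rack `i` only through one symbol `y_i = ∑ j, V_ij c_ij`. With `T
= R ∪ {m}`, the check polynomials `X^(uw) ∏_{i ∉ T} (X^u - λ_i^u)` are admissible for all `w < s`,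
where `s = dbar - kbar + 1` (`sum_rack_parity`).

Let `L = F_m`, which contains every `λ_i` with `i ≠ m`. Multiply the `w`-th check by `x ∈ S_m` and
apply a nonzero `L`-linear `φ : K → L`. The helper coefficients come out of `φ`, so the values `φ(x
y_i)`, for `x` in a basis of `S_m`, give `φ(x λ_m^(uw) Q_m y_m)` with `Q_m ≠ 0`. The elements `x
λ_m^(uw)` span `K`, so `y_m` is determined, and with the surviving nodes of the rack so is the lost
one. Each helper sends `p_m` elements of `L`, which is `p_m [L : F_q] = l / s` base symbols.

It remains to build `S_m` of dimension only `p_m` (`exists_subspace_mul_pow_span`); this is where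
`p_m ≡ 1 (mod s)` enters. -/

/-- A linear map vanishing on the kernel of `f` factors through `f`. -/
lemma exists_factor_of_ker_le {F A B C : Type*} [Field F] [AddCommGroup A] [Module F A]
    [AddCommGroup B] [Module F B] [AddCommGroup C] [Module F C] (f : A →ₗ[F] B) (e : A →ₗ[F] C)
    (h : ∀ a, f a = 0 → e a = 0) : ∃ g : B →ₗ[F] C, ∀ a, g (f a) = e a := by
  have hk : LinearMap.ker f ≤ LinearMap.ker e := fun a ha => h a ha
  obtain ⟨g, hg⟩ := LinearMap.exists_extend
    (((LinearMap.ker f).liftQ e hk).comp f.quotKerEquivRange.symm.toLinearMap)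
  refine ⟨g, fun a => ?_⟩
  have h1 := LinearMap.congr_fun hg ⟨f a, LinearMap.mem_range_self f a⟩
  have h2 : f.quotKerEquivRange.symm ⟨f a, LinearMap.mem_range_self f a⟩ =
      (LinearMap.ker f).mkQ a := by
    rw [LinearEquiv.symm_apply_eq]
    rfl
  simpa [h2] using h1

/-! ### Elements of prime degree and their composita -/

section Degree

variable {Fq K : Type*} [Field Fq] [Field K] [Algebra Fq K]

lemma isIntegral_of_natDegree_minpoly_prime {x : K} {p : ℕ} (hp : p.Prime)
    (hx : (minpoly Fq x).natDegree = p) : IsIntegral Fq x := by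
  by_contra h
  rw [minpoly.eq_zero h, natDegree_zero] at hx
  exact hp.ne_zero hx.symm

/-- A prime-degree extension has no proper intermediate field, and `x ^ u = c` in the base field
would make `x` a root of `X ^ u - c`, of degree `u < p`. -/
lemma adjoin_pow_eq_of_prime_degree {x : K} {p u : ℕ} (hp : p.Prime)
    (hx : (minpoly Fq x).natDegree = p) (hu : 0 < u) (hup : u < p) : Fq⟮x ^ u⟯ = Fq⟮x⟯ := by
  have hint := isIntegral_of_natDegree_minpoly_prime hp hx
  have hle : Fq⟮x ^ u⟯ ≤ Fq⟮x⟯ :=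
    adjoin_simple_le_iff.2 (pow_mem (mem_adjoin_simple_self Fq x) u)
  have hfin : Module.finrank Fq Fq⟮x⟯ = p := by rw [adjoin.finrank hint, hx]
  have : FiniteDimensional Fq Fq⟮x⟯ := adjoin.finiteDimensional hint
  refine eq_of_le_of_finrank_eq hle ?_
  have hdvd := finrank_dvd_of_le_right hle
  rw [hfin] at hdvd ⊢
  refine ((Nat.dvd_prime hp).1 hdvd).resolve_left fun h1 => ?_
  have hbot := finrank_adjoin_simple_eq_one_iff.1 h1
  obtain ⟨c, hc⟩ := mem_bot.1 hbot
  have hdeg := natDegree_le_of_dvd (minpoly.dvd Fq x (p := X ^ u - C c) (by simp [hc]))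
    (X_pow_sub_C_ne_zero hu c)
  rw [natDegree_X_pow_sub_C, hx] at hdeg
  omega

lemma natDegree_minpoly_pow_of_prime_degree {x : K} {p u : ℕ} (hp : p.Prime)
    (hx : (minpoly Fq x).natDegree = p) (hu : 0 < u) (hup : u < p) :
    (minpoly Fq (x ^ u)).natDegree = p := by
  have hint := isIntegral_of_natDegree_minpoly_prime hp hx
  rw [← adjoin.finrank (hint.pow u), adjoin_pow_eq_of_prime_degree hp hx hu hup,
    adjoin.finrank hint, hx]

lemma ne_zero_of_natDegree_minpoly_prime {x : K} {p : ℕ} (hp : p.Prime)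
    (hx : (minpoly Fq x).natDegree = p) : x ≠ 0 := by
  rintro rfl
  rw [minpoly.zero, natDegree_X] at hx
  exact hp.one_lt.ne hx

/-- Extensions of coprime degrees are linearly disjoint, so degrees multiply as generators are
added. -/
lemma finrank_adjoin_image_of_prime_degrees {ι : Type*} [DecidableEq ι] (p : ι → ℕ)
    (hp : ∀ i, (p i).Prime) (hp_inj : Function.Injective p) (x : ι → K)
    (hx : ∀ i, (minpoly Fq (x i)).natDegree = p i) (T : Finset ι) :
    Module.finrank Fq (adjoin Fq (x '' (T : Set ι))) = ∏ i ∈ T, p i := by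
  induction T using Finset.induction_on with
  | empty => simp
  | insert i T hi ih =>
    have hint := isIntegral_of_natDegree_minpoly_prime (hp i) (hx i)
    have h1 : Module.finrank Fq Fq⟮x i⟯ = p i := by rw [adjoin.finrank hint, hx]
    rw [Finset.coe_insert, Set.image_insert_eq, Set.insert_eq, adjoin_union,
      Finset.prod_insert hi, LinearDisjoint.finrank_sup, h1, ih]
    refine LinearDisjoint.of_finrank_coprime ?_
    change (Module.finrank Fq Fq⟮x i⟯).Coprime
      (Module.finrank Fq (adjoin Fq (x '' (T : Set ι))))
    rw [h1, ih]
    refine Nat.Coprime.prod_right fun j hj => (Nat.coprime_primes (hp i) (hp j)).2 fun h => ?_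
    exact hi (hp_inj h ▸ hj)

end Degree

/-- If `K` has degree `s` over `F = L(a)`, where `a` has degree at most `s * r + 1` over `L` and
`r > 0`, then `K` has an `L`-subspace `S` of dimension at most `s * r + 1` such that
`S, S a, …, S a ^ (s - 1)` span `K`. -/
lemma exists_subspace_mul_pow_span {L K : Type*} [Field L] [Field K] [Algebra L K]
    (F : IntermediateField L K) {a : K} (ha : a ∈ F) (ha0 : a ≠ 0) {s r : ℕ} (hr : 0 < r)
    (hs : 0 < s) (hFK : Module.finrank F K = s)
    (hF : ∀ z ∈ F, z ∈ Submodule.span L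
      ((a ^ ·) '' Set.Iio (s * r + 1))) :
    ∃ S : Submodule L K, Module.finrank L S ≤ s * r + 1 ∧
      ∀ D : Submodule L K, (∀ w < s, ∀ x ∈ S, x * a ^ w ∈ D) → D = ⊤ := by
  classical
  have : FiniteDimensional F K := Module.finite_of_finrank_pos (hFK ▸ hs)
  have b : Module.Basis (Fin s) F K := (Module.finBasis F K).reindex (finCongr hFK)
  -- The `s * r` generators `b t * a ^ (t + s * q)` and their shifts yield `b t * a ^ (t + e)` for
  -- all `e < s * r`, one power short of a full window for each `t`. The single extra generator
  -- supplies all `s` missing powers through its own shifts.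
  let g : Option (Fin s × Fin r) → K := fun o =>
    o.elim (∑ t, b t * a ^ (s * r)) fun q => b q.1 * a ^ ((q.1 : ℕ) + s * q.2)
  refine ⟨Submodule.span L (Set.range g), ?_, fun D hD => ?_⟩
  · exact (finrank_range_le_card g).trans (by simp)
  -- Any `s * r + 1` consecutive powers of `a` span `F`, since multiplication by `a ^ c` permutes
  -- `F`.
  have hshift : ∀ (y : K) (c : ℕ), (∀ e < s * r + 1, y * a ^ (c + e) ∈ D) →
      ∀ z ∈ F, y * z ∈ D := by
    intro y c hc z hz
    have hz' : z * (a ^ c)⁻¹ ∈ F := mul_mem hz (inv_mem (pow_mem ha c))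
    have h2 : Submodule.span L ((a ^ ·) '' Set.Iio (s * r + 1)) ≤
        D.comap (LinearMap.mulLeft L (y * a ^ c)) := by
      rw [Submodule.span_le]
      rintro _ ⟨e, he, rfl⟩
      have := hc e he
      simpa [pow_add, mul_assoc] using this
    have h3 := h2 (hF _ hz')
    have h4 : y * a ^ c * (z * (a ^ c)⁻¹) = y * z := by
      field_simp
    rwa [Submodule.mem_comap, LinearMap.mulLeft_apply, h4] at h3
  have hE1 : ∀ (t : Fin s) (e : ℕ), e < s * r → b t * a ^ ((t : ℕ) + e) ∈ D := by
    intro t e he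
    have hmem : g (some (t, ⟨e / s, Nat.div_lt_of_lt_mul he⟩)) ∈
        Submodule.span L (Set.range g) := Submodule.subset_span ⟨_, rfl⟩
    have h1 := hD (e % s) (Nat.mod_lt _ hs) _ hmem
    have h2 : (t : ℕ) + s * (e / s) + e % s = t + e := by
      rw [add_assoc, Nat.div_add_mod]
    simpa [g, mul_assoc, ← pow_add, h2] using h1
  have hE2 : ∀ t : Fin s, ∑ t', b t' * a ^ (s * r + t) ∈ D := by
    intro t
    have hmem : g none ∈ Submodule.span L (Set.range g) := Submodule.subset_span ⟨_, rfl⟩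
    have h1 := hD t t.2 _ hmem
    simpa [g, Finset.sum_mul, mul_assoc, ← pow_add] using h1
  have hsr : s ≤ s * r := Nat.le_mul_of_pos_right s hr
  -- In the `t`-th shift of the extra generator, terms with `t' < t` lie in `D` by induction and
  -- those with `t' > t` by `hE1`; this isolates the missing `b t * a ^ (t + s * r)`.
  have hall : ∀ n (t : Fin s), (t : ℕ) = n → ∀ z ∈ F, b t * z ∈ D := by
    intro n
    induction n using Nat.strong_induction_on with
    | _ n ih =>
      intro t ht
      refine hshift (b t) t fun e he => ?_
      rcases Nat.lt_succ_iff_lt_or_eq.1 he with h | rfl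
      · exact hE1 t e h
      have h1 := hE2 t
      rw [← Finset.add_sum_erase _ _ (Finset.mem_univ t)] at h1
      rw [add_comm (t : ℕ)]
      refine (Submodule.add_mem_iff_left D (Submodule.sum_mem D fun t' ht' => ?_)).1 h1
      have hne : (t' : ℕ) ≠ t := fun h => Finset.ne_of_mem_erase ht' (Fin.ext h)
      rcases lt_or_gt_of_ne hne with hlt | hgt
      · exact ih t' (ht ▸ hlt) t' rfl _ (pow_mem ha _)
      · have h3 := hE1 t' (s * r + t - t') (by omega)
        have h4 : (t' : ℕ) + (s * r + t - t') = s * r + t := by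
          have := t'.2
          omega
        rwa [h4] at h3
  rw [eq_top_iff]
  intro x _
  rw [← b.sum_repr x]
  refine Submodule.sum_mem D fun t _ => ?_
  rw [Algebra.smul_def, mul_comm]
  exact hall t t rfl _ (b.repr x t).2

/-! ### Reed–Solomon codes: MDS property and dual parity checks -/

section ReedSolomon

variable {ι K : Type*} [Field K]

lemma mem_reedSolomon {k : ℕ} {ω : ι → K} {c : ι → K} :
    c ∈ reedSolomon K k ω ↔ ∃ f ∈ degreeLT K k, ∀ t, f.eval (ω t) = c t := by
  simp [reedSolomon, Submodule.mem_map, funext_iff, leval]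

lemma eq_zero_of_mem_degreeLT_of_eval_eq_zero {k : ℕ} {ω : ι → K} (hω : Function.Injective ω)
    {T : Finset ι} (hT : T.card = k) {f : K[X]} (hf : f ∈ degreeLT K k)
    (h : ∀ t ∈ T, f.eval (ω t) = 0) : f = 0 := by
  refine eq_zero_of_degree_lt_of_eval_index_eq_zero T hω.injOn ?_ h
  rw [hT]
  exact mem_degreeLT.1 hf

lemma finrank_reedSolomon [Fintype ι] {k : ℕ} {ω : ι → K} (hω : Function.Injective ω)
    (hk : k ≤ Fintype.card ι) : Module.finrank K (reedSolomon K k ω) = k := by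
  obtain ⟨T, -, hT⟩ := Finset.exists_subset_card_eq (s := (Finset.univ : Finset ι)) hk
  have hinj : Function.Injective ((LinearMap.pi fun t => leval (ω t)).domRestrict
      (degreeLT K k)) := by
    rw [injective_iff_map_eq_zero]
    rintro ⟨f, hf⟩ h
    refine Subtype.ext (eq_zero_of_mem_degreeLT_of_eval_eq_zero hω hT hf fun t _ => ?_)
    exact congr_fun h t
  rw [reedSolomon, ← LinearMap.range_domRestrict, LinearMap.finrank_range_of_inj hinj,
    (degreeLTEquiv K k).finrank_eq, Module.finrank_fin_fun]

lemma isMDS_reedSolomon [Fintype ι] {F : Type*} [Field F] [Algebra F K] {k : ℕ} {ω : ι → K}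
    (hω : Function.Injective ω) (hk : k ≤ Fintype.card ι) :
    IsMDS ((reedSolomon K k ω).restrictScalars F) k := by
  refine ⟨?_, fun T hT c hc c' hc' h => ?_⟩
  · have h1 := Module.finrank_mul_finrank F K (reedSolomon K k ω)
    rw [finrank_reedSolomon hω hk, mul_comm] at h1
    exact h1.symm
  · obtain ⟨f, hf, hfc⟩ := mem_reedSolomon.1 hc
    obtain ⟨f', hf', hfc'⟩ := mem_reedSolomon.1 hc'
    have h0 := eq_zero_of_mem_degreeLT_of_eval_eq_zero hω hT (Submodule.sub_mem _ hf hf')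
      fun t ht => by simp [hfc, hfc', h t ht]
    rw [sub_eq_zero] at h0
    ext t
    rw [← hfc, ← hfc', h0]

/-- The column multipliers of the dual of a Reed-Solomon code. -/
def dualMultiplier [Fintype ι] [DecidableEq ι] (ω : ι → K) (t : ι) : K :=
  (∏ t' ∈ Finset.univ.erase t, (ω t - ω t'))⁻¹

lemma dualMultiplier_ne_zero [Fintype ι] [DecidableEq ι] {ω : ι → K}
    (hω : Function.Injective ω) (t : ι) : dualMultiplier ω t ≠ 0 :=
  inv_ne_zero (Finset.prod_ne_zero_iff.2 fun _ ht' =>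
    sub_ne_zero.2 fun h => Finset.ne_of_mem_erase ht' (hω h).symm)

/-- By Lagrange interpolation the sum is the coefficient of `X ^ (n - 1)` in `P`, where `n` is the
number of points. -/
lemma sum_dualMultiplier_mul_eval [Fintype ι] [DecidableEq ι] {ω : ι → K}
    (hω : Function.Injective ω) {P : K[X]} (hP : P.natDegree + 1 < Fintype.card ι) :
    ∑ t, dualMultiplier ω t * P.eval (ω t) = 0 := by
  have h1 := Lagrange.coeff_eq_sum (s := Finset.univ) (v := ω) hω.injOn (P := P)
    (lt_of_le_of_lt degree_le_natDegree (by
      rw [Finset.card_univ]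
      exact_mod_cast (Nat.lt_succ_self _).trans hP))
  rw [Finset.card_univ, coeff_eq_zero_of_natDegree_lt (by omega)] at h1
  rw [h1]
  exact Finset.sum_congr rfl fun t _ => by rw [dualMultiplier, div_eq_inv_mul]

end ReedSolomon

/-! ### The repair scheme -/

section Repair

variable {Fq K : Type*} [Field Fq] [Field K] [Algebra Fq K] {nbar u : ℕ}

/-- The contents of a rack, weighted by the entries of `V`, are summed up, and the products of the
sum with the `e t` are mapped to the subfield `L`. -/
def rackMap (L : IntermediateField Fq K) {q : ℕ} (φ : K →ₗ[L] L) (e : Fin q → K)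
    (V : Fin u → K) : (Fin u → K) →ₗ[Fq] (Fin q → L) :=
  LinearMap.pi fun t => φ.restrictScalars Fq ∘ₗ LinearMap.mulLeft Fq (e t) ∘ₗ
    ∑ j, LinearMap.mulLeft Fq (V j) ∘ₗ LinearMap.proj j

@[simp]
lemma rackMap_apply (L : IntermediateField Fq K) {q : ℕ} (φ : K →ₗ[L] L) (e : Fin q → K)
    (V : Fin u → K) (x : Fin u → K) (t : Fin q) :
    rackMap L φ e V x t = φ (e t * ∑ j, V j * x j) := by
  simp [rackMap, Finset.mul_sum]

lemma evalPoint_pow {lam : Fin nbar → K} {lam0 : Fq} (hlam0 : lam0 ^ u = 1)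
    (t : Fin nbar × Fin u) : evalPoint lam lam0 t ^ u = lam t.1 ^ u := by
  rw [evalPoint, mul_pow, ← pow_mul, mul_comm (t.2 : ℕ), pow_mul, ← map_pow, hlam0, map_one,
    one_pow, mul_one]

/-- The parity checks of the Reed-Solomon code that come from multiples of the polynomial
vanishing on all racks outside of `T`. -/
lemma sum_rack_parity {lam : Fin nbar → K} {lam0 : Fq} (hlam0 : lam0 ^ u = 1)
    (hinj : Function.Injective (evalPoint (u := u) lam lam0)) {k w : ℕ} {T : Finset (Fin nbar)}
    (hdeg : u * w + u * (nbar - T.card) + k < nbar * u) {c : Fin nbar × Fin u → K}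
    (hc : c ∈ reedSolomon K k (evalPoint lam lam0)) :
    ∑ i ∈ T, ((lam i ^ u) ^ w * ∏ i' ∈ Tᶜ, (lam i ^ u - lam i' ^ u)) *
      ∑ j, dualMultiplier (evalPoint lam lam0) (i, j) * c (i, j) = 0 := by
  obtain ⟨f, hf, hfc⟩ := mem_reedSolomon.1 hc
  let h : K[X] := (X ^ u) ^ w * ∏ i' ∈ Tᶜ, (X ^ u - C (lam i' ^ u))
  have hh : h.natDegree ≤ u * w + u * (nbar - T.card) := by
    refine natDegree_mul_le.trans (add_le_add ?_ ?_)
    · rw [← pow_mul]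
      exact natDegree_X_pow_le _
    · refine (natDegree_prod_le _ _).trans ((Finset.sum_le_card_nsmul _ _ u fun i' _ =>
        natDegree_X_pow_sub_C.le).trans ?_)
      rw [Finset.card_compl, Fintype.card_fin, smul_eq_mul, mul_comm]
  have heval : ∀ t : Fin nbar × Fin u, h.eval (evalPoint lam lam0 t) =
      (lam t.1 ^ u) ^ w * ∏ i' ∈ Tᶜ, (lam t.1 ^ u - lam i' ^ u) := fun t => by
    simp [h, eval_prod, evalPoint_pow hlam0]
  rcases eq_or_ne f 0 with rfl | hf0
  · simp [← hfc]
  have hfk : f.natDegree < k := (natDegree_lt_iff_degree_lt hf0).2 (mem_degreeLT.1 hf)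
  have hP := sum_dualMultiplier_mul_eval hinj (P := h * f) (by
    have := natDegree_mul_le (p := h) (q := f)
    rw [Fintype.card_prod, Fintype.card_fin, Fintype.card_fin]
    omega)
  rw [Fintype.sum_prod_type] at hP
  rw [← hP, ← Finset.sum_subset (Finset.subset_univ T)]
  · refine Finset.sum_congr rfl fun i _ => ?_
    rw [Finset.mul_sum]
    refine Finset.sum_congr rfl fun j _ => ?_
    rw [eval_mul, heval, hfc]
    ring
  · intro i _ hi
    refine Finset.sum_eq_zero fun j _ => ?_
    rw [eval_mul, heval]
    have : ∏ i' ∈ Tᶜ, (lam i ^ u - lam i' ^ u) = 0 :=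
      Finset.prod_eq_zero (Finset.mem_compl.2 hi) (sub_self _)
    simp [this]

/-- The data sent by the helper racks, together with the surviving nodes of the host rack,
determine the failed node. -/
lemma eq_zero_of_rackMap_eq_zero {lam : Fin nbar → K} {lam0 : Fq} (hlam0 : lam0 ^ u = 1)
    (hinj : Function.Injective (evalPoint (u := u) lam lam0)) {k s : ℕ} {m : Fin nbar}
    (L : IntermediateField Fq K) (hL : ∀ i, i ≠ m → lam i ∈ L)
    (hne : ∀ i, i ≠ m → lam i ^ u ≠ lam m ^ u) (S : Submodule L K)
    (hS : ∀ D : Submodule L K, (∀ w < s, ∀ x ∈ S, x * (lam m ^ u) ^ w ∈ D) → D = ⊤)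
    {q : ℕ} (b : Module.Basis (Fin q) L S) {φ : K →ₗ[L] L} (hφ : φ ≠ 0)
    {R : Finset (Fin nbar)} (hm : m ∉ R)
    (hdeg : ∀ w < s, u * w + u * (nbar - (R.card + 1)) + k < nbar * u)
    {c : Fin nbar × Fin u → K} (hc : c ∈ reedSolomon K k (evalPoint lam lam0)) (j : Fin u)
    (hR : ∀ i ∈ R, rackMap L φ (fun t => (b t : K))
      (fun j' => dualMultiplier (evalPoint lam lam0) (i, j')) (fun j' => c (i, j')) = 0)
    (hhost : ∀ j', j' ≠ j → c (m, j') = 0) : c (m, j) = 0 := by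
  set V := dualMultiplier (evalPoint (u := u) lam lam0) with hV
  set y : Fin nbar → K := fun i => ∑ j', V (i, j') * c (i, j') with hy
  have hRS : ∀ i ∈ R, ∀ x ∈ S, φ (x * y i) = 0 := by
    intro i hi x hx
    have h1 : (φ ∘ₗ LinearMap.mulRight L (y i)) ∘ₗ S.subtype = 0 :=
      b.ext fun t => by simpa using congr_fun (hR i hi) t
    simpa using LinearMap.congr_fun h1 ⟨x, hx⟩
  set Q : Fin nbar → K := fun i => ∏ i' ∈ (insert m R)ᶜ, (lam i ^ u - lam i' ^ u) with hQ
  have hQL : ∀ i ∈ R, Q i ∈ L := fun i hi => prod_mem fun i' hi' => by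
    rw [Finset.mem_compl, Finset.mem_insert, not_or] at hi'
    exact sub_mem (pow_mem (hL i (ne_of_mem_of_not_mem hi hm)) u) (pow_mem (hL i' hi'.1) u)
  have hQm : Q m ≠ 0 := Finset.prod_ne_zero_iff.2 fun i' hi' => by
    rw [Finset.mem_compl, Finset.mem_insert, not_or] at hi'
    exact sub_ne_zero.2 (hne i' hi'.1).symm
  -- The parity checks put every `x * (lam m ^ u) ^ w` in this kernel, so the spanning property of
  -- `S` makes it all of `K`.
  have htop := hS (LinearMap.ker (φ ∘ₗ LinearMap.mulRight L (Q m * y m))) fun w hw x hx => by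
    have h1 := sum_rack_parity hlam0 hinj (T := insert m R) (w := w)
      (by rw [Finset.card_insert_of_notMem hm]; exact hdeg w hw) hc
    rw [Finset.sum_insert hm] at h1
    have h2 : x * (lam m ^ u) ^ w * (Q m * y m) =
        -∑ i ∈ R, ((lam i ^ u) ^ w * Q i) * (x * y i) := by
      have h3 : ∑ i ∈ R, ((lam i ^ u) ^ w * Q i) * (x * y i) =
          x * ∑ i ∈ R, ((lam i ^ u) ^ w * Q i) * y i := by
        rw [Finset.mul_sum]
        exact Finset.sum_congr rfl fun i _ => by ring
      rw [h3]
      linear_combination x * h1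
    rw [LinearMap.mem_ker, LinearMap.comp_apply, LinearMap.mulRight_apply, h2, map_neg, map_sum,
      neg_eq_zero]
    refine Finset.sum_eq_zero fun i hi => ?_
    have hmem : (lam i ^ u) ^ w * Q i ∈ L :=
      mul_mem (pow_mem (pow_mem (hL i (ne_of_mem_of_not_mem hi hm)) u) w) (hQL i hi)
    have h4 : ((lam i ^ u) ^ w * Q i) * (x * y i) =
        (⟨_, hmem⟩ : L) • (x * y i) := rfl
    rw [h4, map_smul, hRS i hi x hx, smul_zero]
  have hym : y m = 0 := by
    by_contra hym
    refine hφ (LinearMap.ext fun z => ?_)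
    have hz : z * (Q m * y m)⁻¹ ∈ LinearMap.ker (φ ∘ₗ LinearMap.mulRight L (Q m * y m)) :=
      htop ▸ Submodule.mem_top
    rw [LinearMap.mem_ker, LinearMap.comp_apply, LinearMap.mulRight_apply, mul_assoc,
      inv_mul_cancel₀ (mul_ne_zero hQm hym), mul_one] at hz
    exact hz
  have hsingle : y m = V (m, j) * c (m, j) :=
    Finset.sum_eq_single j (fun j' _ hj' => by rw [hhost j' hj', mul_zero]) (by simp)
  rw [hsingle] at hym
  exact (mul_eq_zero.1 hym).resolve_left (dualMultiplier_ne_zero hinj _)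

/-- By linearity it suffices that zero received data force a zero failed node; `g` is then a
factorization. The helper maps involve only `L`, `S` and `φ`, none of which depends on `R`. -/
lemma exists_linearRepairScheme {lam : Fin nbar → K} {lam0 : Fq} (hlam0 : lam0 ^ u = 1)
    (hinj : Function.Injective (evalPoint (u := u) lam lam0)) {k s dbar : ℕ} (m : Fin nbar)
    (L : IntermediateField Fq K) [FiniteDimensional Fq K] (hL : ∀ i, i ≠ m → lam i ∈ L)
    (hne : ∀ i, i ≠ m → lam i ^ u ≠ lam m ^ u) (S : Submodule L K)
    (hS : ∀ D : Submodule L K, (∀ w < s, ∀ x ∈ S, x * (lam m ^ u) ^ w ∈ D) → D = ⊤)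
    (hdeg : ∀ w < s, u * w + u * (nbar - (dbar + 1)) + k < nbar * u) (j : Fin u) :
    ∃ scheme : LinearRepairScheme ((reedSolomon K k (evalPoint (u := u) lam lam0)).restrictScalars Fq)
      dbar m j, ∀ i, scheme.β i = Module.finrank L S * Module.finrank Fq L := by
  classical
  let b := Module.finBasis L S
  obtain ⟨φ, hφ1⟩ : ∃ φ : Module.Dual L K, φ 1 ≠ 0 := by
    by_contra! h
    exact one_ne_zero ((Module.forall_dual_apply_eq_zero_iff L (1 : K)).1 h)
  have hφ : φ ≠ 0 := fun h => hφ1 (by simp [h])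
  have hdim : Module.finrank Fq (Fin (Module.finrank L S) → L) =
      Module.finrank L S * Module.finrank Fq L := by
    simp [Module.finrank_pi_fintype]
  let E : (Fin (Module.finrank L S) → L) ≃ₗ[Fq]
      (Fin (Module.finrank L S * Module.finrank Fq L) → Fq) :=
    LinearEquiv.ofFinrankEq _ _ (by rw [hdim, Module.finrank_fin_fun])
  let f (i : Fin nbar) := E.toLinearMap ∘ₗ rackMap L φ (fun t => (b t : K))
    (fun j' => dualMultiplier (evalPoint (u := u) lam lam0) (i, j'))
  let C := (reedSolomon K k (evalPoint (u := u) lam lam0)).restrictScalars Fq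
  let data (R : Finset (Fin nbar)) : C →ₗ[Fq] ((i : R) → Fin _ → Fq) ×
      ({j' : Fin u // j' ≠ j} → K) :=
    LinearMap.prod
      (LinearMap.pi fun i => f i ∘ₗ (LinearMap.funLeft Fq K fun j' => (i.1, j')) ∘ₗ C.subtype)
      ((LinearMap.funLeft Fq K fun j' => (m, j'.1)) ∘ₗ C.subtype)
  have hg : ∀ R : Finset (Fin nbar), ∃ g : (((i : R) → Fin _ → Fq) ×
      ({j' : Fin u // j' ≠ j} → K)) →ₗ[Fq] K, R.card = dbar → m ∉ R → ∀ c : C,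
        g (data R c) = c.1 (m, j) := by
    intro R
    by_cases hR : R.card = dbar ∧ m ∉ R
    · obtain ⟨g, hg⟩ := exists_factor_of_ker_le (data R) (LinearMap.proj (m, j) ∘ₗ C.subtype)
        fun c hc => by
          refine eq_zero_of_rackMap_eq_zero hlam0 hinj L hL hne S hS b hφ hR.2
            (hR.1.symm ▸ hdeg) c.2 j (fun i hi => ?_) (fun j' hj' => ?_)
          · exact E.map_eq_zero_iff.1 (congr_fun (Prod.ext_iff.1 hc).1 ⟨i, hi⟩)
          · exact congr_fun (Prod.ext_iff.1 hc).2 ⟨j', hj'⟩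
      exact ⟨g, fun _ _ => hg⟩
    · exact ⟨0, fun h1 h2 => absurd ⟨h1, h2⟩ hR⟩
  choose g hg using hg
  exact ⟨{ β := fun _ => _, f := f, g := g, repairs := fun R h1 h2 c hc => hg R h1 h2 ⟨c, hc⟩ },
    fun _ => rfl⟩

end Repair

/-! ### The field tower, the subspaces `S_i` and the evaluation points -/

section Tower

variable {Fq K : Type*} [Field Fq] [Field K] [Algebra Fq K] {nbar : ℕ} {p : Fin nbar → ℕ}
  {lam : Fin nbar → K}

lemma finrank_fullField (hp : ∀ i, (p i).Prime) (hp_inj : Function.Injective p)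
    (hlam : ∀ i, (minpoly Fq (lam i)).natDegree = p i) :
    Module.finrank Fq (fullField Fq lam) = ∏ i, p i := by
  have := finrank_adjoin_image_of_prime_degrees p hp hp_inj lam hlam Finset.univ
  rwa [Finset.coe_univ, Set.image_univ] at this

lemma finrank_omitField_mul (hp : ∀ i, (p i).Prime) (hp_inj : Function.Injective p)
    (hlam : ∀ i, (minpoly Fq (lam i)).natDegree = p i) (i : Fin nbar) :
    p i * Module.finrank Fq (omitField Fq lam i) = ∏ i, p i := by
  have := finrank_adjoin_image_of_prime_degrees p hp hp_inj lam hlam (Finset.univ.erase i)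
  have h2 : ((Finset.univ.erase i : Finset (Fin nbar)) : Set (Fin nbar)) = {j | j ≠ i} := by
    ext
    simp
  rw [h2] at this
  rw [this, Finset.mul_prod_erase _ _ (Finset.mem_univ i)]

lemma finrank_eq_mul_prod (hp : ∀ i, (p i).Prime) (hp_inj : Function.Injective p)
    (hlam : ∀ i, (minpoly Fq (lam i)).natDegree = p i) {s : ℕ}
    (hK : Module.finrank (fullField Fq lam) K = s) : Module.finrank Fq K = s * ∏ i, p i := by
  rw [← Module.finrank_mul_finrank Fq (fullField Fq lam) K, hK, finrank_fullField hp hp_inj hlam,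
    mul_comm]

lemma restrictScalars_adjoin_pow_omitField (i : Fin nbar) (hp : (p i).Prime)
    (hlam : (minpoly Fq (lam i)).natDegree = p i) {u : ℕ} (hu : 0 < u) (hup : u < p i) :
    (adjoin (omitField Fq lam i) {lam i ^ u}).restrictScalars Fq = fullField Fq lam := by
  rw [restrictScalars_adjoin_eq_sup, adjoin_pow_eq_of_prime_degree hp hlam hu hup, ← adjoin_union]
  congr 1
  rw [← Set.image_singleton (f := lam), ← Set.image_union]
  convert Set.image_univ
  ext j
  simp [em]

lemma exists_repair_subspace (hp : ∀ i, (p i).Prime) (hp_inj : Function.Injective p)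
    (hlam : ∀ i, (minpoly Fq (lam i)).natDegree = p i) {s u : ℕ} (hs : 0 < s)
    (hK : Module.finrank (fullField Fq lam) K = s) (i : Fin nbar) (hmod : p i ≡ 1 [MOD s])
    (hu : 0 < u) (hup : u < p i) :
    ∃ S : Submodule (omitField Fq lam i) K, Module.finrank (omitField Fq lam i) S = p i ∧
      ∀ D : Submodule (omitField Fq lam i) K,
        (∀ w < s, ∀ x ∈ S, x * (lam i ^ u) ^ w ∈ D) → D = ⊤ := by
  classical
  set L := omitField Fq lam i with hLdef
  have hKs := finrank_eq_mul_prod hp hp_inj hlam hK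
  have hprod := finrank_omitField_mul hp hp_inj hlam i
  have hpos : 0 < ∏ i, p i := Finset.prod_pos fun i _ => (hp i).pos
  have hLpos : 0 < Module.finrank Fq L := Nat.pos_of_mul_pos_left (hprod ▸ hpos)
  have : FiniteDimensional Fq K := Module.finite_of_finrank_pos (hKs ▸ Nat.mul_pos hs hpos)
  have hLK : Module.finrank L K = s * p i := by
    have h1 := Module.finrank_mul_finrank Fq L K
    rw [hKs, ← hprod] at h1
    refine Nat.eq_of_mul_eq_mul_left hLpos (h1.trans ?_)
    ring
  obtain ⟨r, hr⟩ := (Nat.modEq_iff_dvd' (hp i).one_le).1 hmod.symm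
  have hpr : p i = s * r + 1 := by
    have := (hp i).one_le
    omega
  have hr0 : 0 < r := by
    rcases Nat.eq_zero_or_pos r with rfl | h
    · exact absurd hpr (hp i).ne_one
    · exact h
  have hFres := restrictScalars_adjoin_pow_omitField i (hp i) (hlam i) hu hup
  have hint : IsIntegral Fq (lam i ^ u) :=
    (isIntegral_of_natDegree_minpoly_prime (hp i) (hlam i)).pow u
  obtain ⟨S, hS1, hS2⟩ := exists_subspace_mul_pow_span (adjoin L {lam i ^ u})
    (mem_adjoin_simple_self L (lam i ^ u))
    (pow_ne_zero u (ne_zero_of_natDegree_minpoly_prime (hp i) (hlam i))) hr0 hs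
    (by rw [← hK, ← hFres]; rfl) (fun z hz => by
      -- Spanning needs only a monic polynomial over `L` with the right degree and root, so
      -- irreducibility over `L` is not required.
      have hmonic : ((minpoly Fq (lam i ^ u)).map (algebraMap Fq L)).Monic :=
        (minpoly.monic hint).map _
      have hspan := Submodule.span_range_natDegree_eq_adjoin (x := lam i ^ u) hmonic (by simp)
      rw [natDegree_map, natDegree_minpoly_pow_of_prime_degree (hp i) (hlam i) hu hup, hpr,
        Finset.coe_image, Finset.coe_range] at hspan
      rw [hspan, Subalgebra.mem_toSubmodule,
        ← adjoin_simple_toSubalgebra_of_isAlgebraic (hint.tower_top (A := L)).isAlgebraic]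
      exact hz)
  refine ⟨S, le_antisymm (hpr ▸ hS1) ?_, hS2⟩
  have : FiniteDimensional L K := FiniteDimensional.right Fq L K
  -- Lower bound on the dimension: `s` shifts of `S` fill `K`, which has dimension `s * p i` over
  -- `L`.
  let Φ : (Fin s → S) →ₗ[L] K := LinearMap.lsum L (fun _ => S) L fun w =>
    LinearMap.mulRight L ((lam i ^ u) ^ (w : ℕ)) ∘ₗ S.subtype
  have hΦ : LinearMap.range Φ = ⊤ := hS2 _ fun w hw x hx =>
    ⟨Pi.single ⟨w, hw⟩ ⟨x, hx⟩, by
      rw [LinearMap.lsum_piSingle]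
      rfl⟩
  have hTle := LinearMap.finrank_range_le Φ
  rw [hΦ, finrank_top, hLK, Module.finrank_pi_fintype, Finset.sum_const, Finset.card_univ,
    Fintype.card_fin, smul_eq_mul] at hTle
  exact Nat.le_of_mul_le_mul_left hTle hs

lemma sum_image_mul_pow_eq_univ {F L : Type*} [Field F] [Field L] [Algebra F L] (S : Submodule F L)
    (a : L) {s u : ℕ}
    (hS : ∀ D : Submodule F L, (∀ w < s, ∀ x ∈ S, x * (a ^ u) ^ w ∈ D) → D = ⊤) :
    ∑ w ∈ Finset.range s, (fun γ : L => γ * a ^ (u * w)) '' (S : Set L) = Set.univ := by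
  have h0 : ∀ T : Finset ℕ, ∑ w ∈ T, (fun γ : L => γ * a ^ (u * w)) '' (S : Set L) =
      ((∑ w ∈ T, S.map (LinearMap.mulRight F (a ^ (u * w))) : Submodule F L) : Set L) := by
    intro T
    induction T using Finset.induction_on with
    | empty => simp [Set.singleton_zero]
    | insert w T hw ih =>
      rw [Finset.sum_insert hw, Finset.sum_insert hw, ih, Submodule.add_eq_sup,
        Submodule.coe_sup]
      rfl
  rw [h0, hS (∑ w ∈ Finset.range s, S.map (LinearMap.mulRight F (a ^ (u * w)))), Submodule.top_coe]
  intro w hw x hx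
  have hle : S.map (LinearMap.mulRight F (a ^ (u * w))) ≤
      ∑ w ∈ Finset.range s, S.map (LinearMap.mulRight F (a ^ (u * w))) :=
    Finset.single_le_sum (f := fun w => S.map (LinearMap.mulRight F (a ^ (u * w))))
      (fun _ _ => bot_le) (Finset.mem_range.2 hw)
  exact hle ⟨x, hx, by simp [pow_mul]⟩

lemma pow_injective_of_prime_degrees (hp : ∀ i, (p i).Prime) (hp_inj : Function.Injective p)
    (hlam : ∀ i, (minpoly Fq (lam i)).natDegree = p i) {u : ℕ} (hu : 0 < u)
    (hup : ∀ i, u < p i) : Function.Injective fun i => lam i ^ u := fun i i' h => by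
  refine hp_inj ?_
  rw [← natDegree_minpoly_pow_of_prime_degree (hp i) (hlam i) hu (hup i),
    ← natDegree_minpoly_pow_of_prime_degree (hp i') (hlam i') hu (hup i')]
  exact congrArg (fun x => (minpoly Fq x).natDegree) h

/-- The `u`-th power separates the racks; the order of `lam0` separates nodes within one. -/
lemma evalPoint_injective {u : ℕ} {lam0 : Fq} (hlam0 : orderOf lam0 = u) (h0 : ∀ i, lam i ≠ 0)
    (hinj : Function.Injective fun i => lam i ^ u) :
    Function.Injective (evalPoint (u := u) lam lam0) := by
  rintro ⟨i, j⟩ ⟨i', j'⟩ h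
  have hpow : lam0 ^ u = 1 := hlam0 ▸ pow_orderOf_eq_one lam0
  have hi : i = i' := hinj (by
    simpa only [evalPoint_pow hpow] using congrArg (· ^ u) h)
  subst hi
  have hj := mul_left_cancel₀ (h0 i) h
  rw [← map_pow, ← map_pow] at hj
  have hj' := pow_injOn_Iio_orderOf (x := lam0) (by simp [hlam0]) (by simp [hlam0])
    ((algebraMap Fq K).injective hj)
  exact Prod.ext rfl (Fin.ext hj')

end Tower

end RackRS

end

theorem mainTheorem4 {Fq K : Type*} [Field Fq] [Finite Fq] [Field K] [Algebra Fq K]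
    (nbar u k kbar v dbar sbar : ℕ)
    (hk : k = kbar * u + v) (hv : v < u) (huk : u ≤ k)
    (hkd : kbar ≤ dbar) (hdn : dbar < nbar) (hs : sbar = dbar - kbar + 1)
    (p : Fin nbar → ℕ) (hp : ∀ i, (p i).Prime) (hp_inj : Function.Injective p)
    (hp_mod : ∀ i, p i ≡ 1 [MOD sbar]) (hp_gt : ∀ i, u < p i)
    (lam : Fin nbar → K) (hlam : ∀ i, (minpoly Fq (lam i)).natDegree = p i)
    (lam0 : Fq) (hlam0 : orderOf lam0 = u)
    (hK : Module.finrank (RackRS.fullField Fq lam) K = sbar) :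
    (∀ i : Fin nbar, ∃ S : Submodule (RackRS.omitField Fq lam i) K,
      Module.finrank (RackRS.omitField Fq lam i) S = p i ∧
      ∑ w ∈ Finset.range sbar, (fun γ : K => γ * lam i ^ (u * w)) '' (S : Set K) = Set.univ) ∧
    Module.finrank Fq K = sbar * ∏ i, p i ∧
    Function.Injective (RackRS.evalPoint (u := u) lam lam0) ∧
    RackRS.IsMDS
      ((RackRS.reedSolomon K k (RackRS.evalPoint (u := u) lam lam0)).restrictScalars Fq) k ∧
    RackRS.SupportsOptimalRepair
      ((RackRS.reedSolomon K k (RackRS.evalPoint (u := u) lam lam0)).restrictScalars Fq)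
      kbar dbar := by
  have hu : 0 < u := (Nat.zero_le v).trans_lt hv
  have hs0 : 0 < sbar := by omega
  have hpow : lam0 ^ u = 1 := hlam0 ▸ pow_orderOf_eq_one lam0
  have hpow_inj := RackRS.pow_injective_of_prime_degrees hp hp_inj hlam hu hp_gt
  have hω : Function.Injective (RackRS.evalPoint (u := u) lam lam0) :=
    RackRS.evalPoint_injective hlam0
      (fun i => RackRS.ne_zero_of_natDegree_minpoly_prime (hp i) (hlam i)) hpow_inj
  have hsub := fun i =>
    RackRS.exists_repair_subspace hp hp_inj hlam hs0 hK i (hp_mod i) hu (hp_gt i)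
  have hl := RackRS.finrank_eq_mul_prod hp hp_inj hlam hK
  -- Additive parameters remove the truncated subtractions.
  obtain ⟨b, rfl⟩ : ∃ b, nbar = dbar + 1 + b := Nat.exists_eq_add_of_lt hdn |>.imp fun b h => by
    omega
  obtain ⟨a, rfl⟩ : ∃ a, dbar = kbar + a := Nat.exists_eq_add_of_le hkd
  have hsa : sbar = a + 1 := by omega
  refine ⟨fun i => ?_, hl, hω, RackRS.isMDS_reedSolomon hω ?_, fun m j => ?_⟩
  · obtain ⟨S, hS, hspan⟩ := hsub i
    exact ⟨S, hS, RackRS.sum_image_mul_pow_eq_univ S (lam i) hspan⟩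
  · rw [Fintype.card_prod, Fintype.card_fin, Fintype.card_fin]
    nlinarith
  · obtain ⟨S, hS, hspan⟩ := hsub m
    have : FiniteDimensional Fq K := Module.finite_of_finrank_pos
      (hl ▸ Nat.mul_pos hs0 (Finset.prod_pos fun i _ => (hp i).pos))
    obtain ⟨scheme, hscheme⟩ := RackRS.exists_linearRepairScheme (dbar := kbar + a) (k := k) hpow
      hω m (RackRS.omitField Fq lam m)
      (fun i hi => IntermediateField.subset_adjoin _ _ ⟨i, hi, rfl⟩)
      -- In the worst case `w = a` the left side is `nbar * u - u + v`, below `nbar * u` because `v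
      -- < u`.
      (fun i hi h => hi (hpow_inj h)) S hspan (fun w hw => by
        have h1 : u * w ≤ u * a := Nat.mul_le_mul_left u (by omega)
        have h2 : kbar + a + 1 + b - (kbar + a + 1) = b := by omega
        rw [h2, hk]
        nlinarith) j
    refine ⟨scheme, fun R hR _ => ?_⟩
    have hsq : ((kbar + a : ℕ) : ℚ) - (kbar : ℚ) + 1 = sbar := by
      rw [hsa]
      push_cast
      ring
    have hsne : (sbar : ℚ) ≠ 0 := Nat.cast_ne_zero.2 hs0.ne'
    rw [RackRS.LinearRepairScheme.bandwidth, Finset.sum_congr rfl fun i _ => hscheme i,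
      Finset.sum_const, hR, hS, RackRS.finrank_omitField_mul hp hp_inj hlam m, hl, hsq,
      eq_div_iff hsne, smul_eq_mul]
    push_cast
    ring
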